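/- Let $\Omega\subset\mathbb R^3$ be a bounded domain with boundary $\Gamma=\partial\Omega$ of class $C^3$ and outer unit normal $n$. Consider a rigid body whose cavity $\Omega$ is completely filled by a fluid of density $1$. The mass distribution of the solid is a finite Borel measure $m$ on $\mathbb R^3$ with bounded support and $m(\Omega)=0$ that is not concentrated on a line through the origin. The origin is the center of mass of the whole system (solid and fluid), and the coordinate axes are principal axes of inertia of the whole system. Let $\mathbb I=\mathrm{diag}[\lambda_1,\lambda_2,\lambda_3]$ be the inertia tensor of the whole system, that is $$\mathbb I_{ij}=\int_\Omega(\delta_{ij}|x|^2-x_ix_j)\,dx+\int(\delta_{ij}|x|^2-x_ix_j)\,dm .$$ For $1<q<\infty$ let $$L_{q,\sigma}(\Omega)=\{v\in L_q(\Omega)^3:\ \mathrm{div}\,v=0 \text{ in }\Omega,\ (v|n)=0\text{ on }\Gamma\},\qquad X_0=L_{q,\sigma}(\Omega)\times\mathbb R^3$$ (real fields; $\mathrm{div}\,v=0$ in the sense of distributions, $(v|n)=0$ in the sense of the generalized normal trace), and let $\mathbb P$ be the Helmholtz projection of $L_q(\Omega)^3$ onto $L_{q,\sigma}(\Omega)$,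 that is the bounded projection onto $L_{q,\sigma}(\Omega)$ with kernel $\{\nabla\varphi:\varphi\in H^1_q(\Omega)\}$. For $v\in L_{q,\sigma}(\Omega)$ and ${\sf a}\in\mathbb R^3$ put $$Kv=\mathbb P\Big(x\times\mathbb I^{-1}\int_\Omega (x\times v)\,dx\Big),\qquad E(v,{\sf a})=\big(v+Kv-\mathbb P(x\times{\sf a}),\ \mathbb I{\sf a}\big).$$ **Proposition.** Let $1<q<\infty$. Then $I+K$ is invertible on $L_{q,\sigma}(\Omega)$ (with bounded inverse). Define $C$ by $I+C=(I+K)^{-1}$. The bounded operator $E$ is invertible on $X_0$ (with bounded inverse), and $$E^{-1}=\begin{bmatrix} I+C & (I+C)\,\mathbb P(x\times\mathbb I^{-1}\,\cdot\,)\\ 0&\mathbb I^{-1}\end{bmatrix}.$$ Moreover: (a) $C$ is a compact, in fact a finite-rank, operator on $L_{q,\sigma}(\Omega)$. (b) $I+C$ is invertible on $L_{q,\sigma}(\Omega)$. For $q=2$, $I+C$ is symmetric and positive definite on $L_{2,\sigma}(\Omega)$: $((I+C)v|w)_{L_2(\Omega)}=(v|(I+C)w)_{L_2(\Omega)}$ for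 all $v,w\in L_{2,\sigma}(\Omega)$, and there is a constant $c>0$ with $((I+C)v|v)_{L_2(\Omega)}\ge c\,|v|^2_{L_2(\Omega)}$ for all $v\in L_{2,\sigma}(\Omega)$. -/

import Mathlib

open MeasureTheory Set Filter Topology
open scoped ENNReal ContDiff

noncomputable section

/-- Three-dimensional Euclidean space. -/
abbrev E3 : Type := EuclideanSpace ℝ (Fin 3)

/-- The cross product `a × b` on Euclidean three-space. -/
def cross (a b : E3) : E3 := WithLp.toLp 2 (crossProduct a.ofLp b.ofLp)

/-- The cross product as a bilinear map. -/
def crossₗ : E3 →ₗ[ℝ] E3 →ₗ[ℝ] E3 :=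
  LinearMap.mk₂ ℝ cross
    (fun a b c => by ext i; simp [cross])
    (fun r a b => by ext i; simp [cross])
    (fun a b c => by ext i; simp [cross])
    (fun r a b => by ext i; simp [cross])

/-- The cross product as a continuous bilinear map. -/
def crossL : E3 →L[ℝ] E3 →L[ℝ] E3 := crossₗ.toContinuousBilinearMap

theorem crossL_apply (a b : E3) : crossL a b = cross a b := rfl

/-- The boundary of `Ω` is of class `C³`: near every boundary point, `Ω` is the set where a `C³`
function with nonvanishing derivative at that point is negative. -/
def HasC3Boundary (Ω : Set E3) : Prop :=
  ∀ p ∈ frontier Ω, ∃ U ∈ 𝓝 p, ∃ ρ : E3 → ℝ,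
    ContDiff ℝ 3 ρ ∧ fderiv ℝ ρ p ≠ 0 ∧ Ω ∩ U = {x ∈ U | ρ x < 0}

/-- The space `L_q(Ω)³` of (real) vector fields, normed by `(∫_Ω |v|^q)^{1/q}`. -/
abbrev LqField (Ω : Set E3) (q : ℝ≥0∞) : Type := Lp E3 q (volume.restrict Ω)

/-- `g` is the weak gradient of `φ` in `Ω`; with `φ ∈ L_q(Ω)` and `g ∈ L_q(Ω)³` this says that
`φ` is in the Sobolev space `H¹_q(Ω)` and `g = ∇φ`. -/
def IsWeakGradient (Ω : Set E3) (φ : E3 → ℝ) (g : E3 → E3) : Prop :=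
  ∀ ψ : E3 → ℝ, ContDiff ℝ ∞ ψ → HasCompactSupport ψ → tsupport ψ ⊆ Ω →
    ∫ x in Ω, φ x • gradient ψ x = - ∫ x in Ω, ψ x • g x

/-- `div v = 0` in `Ω` in the sense of distributions. -/
def IsDivFree (Ω : Set E3) (v : E3 → E3) : Prop :=
  ∀ ψ : E3 → ℝ, ContDiff ℝ ∞ ψ → HasCompactSupport ψ → tsupport ψ ⊆ Ω →
    ∫ x in Ω, inner ℝ (v x) (gradient ψ x) = 0

/-- `(v | n) = 0` on `∂Ω`, for a divergence-free field `v ∈ L_q(Ω)³`. By definition the normal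
trace of such a field is the functional
`⟨(v | n), φ⟩ = ∫_Ω (v | ∇φ) + ∫_Ω (div v) φ = ∫_Ω (v | ∇φ)` of `φ ∈ H¹_{q'}(Ω)`, where
`1/q + 1/q' = 1`. -/
def HasZeroNormalTrace (Ω : Set E3) (q : ℝ≥0∞) (v : E3 → E3) : Prop :=
  ∀ (φ : Lp ℝ q.conjExponent (volume.restrict Ω)) (g : LqField Ω q.conjExponent),
    IsWeakGradient Ω φ g → ∫ x in Ω, inner ℝ (v x) (g x) = 0

section Solenoidal

variable {Ω : Set E3} {q : ℝ≥0∞} [hq : Fact (1 ≤ q)]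

theorem integrable_inner_conj (v : LqField Ω q) {h : E3 → E3}
    (hh : MemLp h q.conjExponent (volume.restrict Ω)) :
    Integrable (fun x => inner ℝ (v x) (h x)) (volume.restrict Ω) := by
  haveI := ENNReal.HolderConjugate.conjExponent hq.out
  exact memLp_one_iff_integrable.1
    ((innerSL ℝ (E := E3)).memLp_of_bilin 1 (Lp.memLp v) hh)

theorem integral_inner_add_conj (v w : LqField Ω q) {h : E3 → E3}
    (hh : MemLp h q.conjExponent (volume.restrict Ω)) :
    ∫ x in Ω, inner ℝ ((v + w : LqField Ω q) x) (h x) =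
      (∫ x in Ω, inner ℝ (v x) (h x)) + ∫ x in Ω, inner ℝ (w x) (h x) := by
  rw [← integral_add (integrable_inner_conj v hh) (integrable_inner_conj w hh)]
  refine integral_congr_ae ?_
  filter_upwards [Lp.coeFn_add v w] with x hx
  rw [hx, Pi.add_apply, inner_add_left]

theorem integral_inner_smul_conj (c : ℝ) (v : LqField Ω q) (h : E3 → E3) :
    ∫ x in Ω, inner ℝ ((c • v : LqField Ω q) x) (h x) = c * ∫ x in Ω, inner ℝ (v x) (h x) := by
  rw [← integral_const_mul]
  refine integral_congr_ae ?_
  filter_upwards [Lp.coeFn_smul c v] with x hx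
  rw [hx, Pi.smul_apply, real_inner_smul_left]

theorem integral_inner_zero (h : E3 → E3) :
    ∫ x in Ω, inner ℝ ((0 : LqField Ω q) x) (h x) = 0 := by
  have : (fun x => inner ℝ ((0 : LqField Ω q) x) (h x)) =ᵐ[volume.restrict Ω] fun _ => (0 : ℝ) := by
    filter_upwards [Lp.coeFn_zero E3 q (volume.restrict Ω)] with x hx
    rw [hx, Pi.zero_apply, inner_zero_left]
  rw [integral_congr_ae this, integral_zero]

theorem memLp_gradient {ψ : E3 → ℝ} (h1 : ContDiff ℝ ∞ ψ) (h2 : HasCompactSupport ψ)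
    (p : ℝ≥0∞) : MemLp (gradient ψ) p (volume.restrict Ω) := by
  have hc : Continuous (gradient ψ) :=
    (InnerProductSpace.toDual ℝ E3).symm.continuous.comp (h1.continuous_fderiv (by simp))
  have hs : HasCompactSupport (gradient ψ) :=
    (h2.fderiv (𝕜 := ℝ)).comp_left (map_zero (InnerProductSpace.toDual ℝ E3).symm)
  exact (hc.memLp_of_hasCompactSupport (μ := volume) hs).restrict Ω

end Solenoidal

/-- The space `L_{q,σ}(Ω)` of solenoidal fields: `v ∈ L_q(Ω)³` with `div v = 0` in `Ω` and
`(v | n) = 0` on `∂Ω`. -/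
def Lsigma (Ω : Set E3) (q : ℝ≥0∞) [Fact (1 ≤ q)] : Submodule ℝ (LqField Ω q) where
  carrier := {v | IsDivFree Ω v ∧ HasZeroNormalTrace Ω q v}
  zero_mem' := ⟨fun _ _ _ _ => integral_inner_zero _, fun _ _ _ => integral_inner_zero _⟩
  add_mem' := by
    rintro v w ⟨hv1, hv2⟩ ⟨hw1, hw2⟩
    refine ⟨fun ψ h1 h2 h3 => ?_, fun φ g h => ?_⟩
    · rw [integral_inner_add_conj v w (memLp_gradient h1 h2 _), hv1 ψ h1 h2 h3, hw1 ψ h1 h2 h3,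
        add_zero]
    · rw [integral_inner_add_conj v w (Lp.memLp g), hv2 φ g h, hw2 φ g h, add_zero]
  smul_mem' := by
    rintro c v ⟨hv1, hv2⟩
    refine ⟨fun ψ h1 h2 h3 => ?_, fun φ g h => ?_⟩
    · rw [integral_inner_smul_conj, hv1 ψ h1 h2 h3, mul_zero]
    · rw [integral_inner_smul_conj, hv2 φ g h, mul_zero]

/-- `P` is the Helmholtz projection of `L_q(Ω)³`: the bounded projection onto `L_{q,σ}(Ω)` whose
kernel is the space of gradients `{∇φ : φ ∈ H¹_q(Ω)}`. -/
def IsHelmholtzProjection (Ω : Set E3) (q : ℝ≥0∞) [Fact (1 ≤ q)]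
    (P : LqField Ω q →L[ℝ] Lsigma Ω q) : Prop :=
  (∀ v : Lsigma Ω q, P v = v) ∧
    ∀ u : LqField Ω q, P u = 0 ↔ ∃ φ : Lp ℝ q (volume.restrict Ω), IsWeakGradient Ω φ u

/-- There is at most one Helmholtz projection. -/
theorem IsHelmholtzProjection.unique {Ω : Set E3} {q : ℝ≥0∞} [Fact (1 ≤ q)]
    {P Q : LqField Ω q →L[ℝ] Lsigma Ω q}
    (hP : IsHelmholtzProjection Ω q P) (hQ : IsHelmholtzProjection Ω q Q) : P = Q := by
  ext1 u
  have h : P (u - (P u : LqField Ω q)) = 0 := by rw [map_sub, hP.1, sub_self]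
  have h' := (hQ.2 _).2 ((hP.2 _).1 h)
  rw [map_sub, hQ.1, sub_eq_zero] at h'
  exact h'.symm

open Classical in
/-- The Helmholtz projection `ℙ : L_q(Ω)³ → L_{q,σ}(Ω)`. It exists for every bounded domain with
boundary of class `C³` and every `1 < q < ∞`, and it is unique; the value `0` is a placeholder
for sets `Ω` and exponents without a Helmholtz projection. -/
def helmholtz (Ω : Set E3) (q : ℝ≥0∞) [Fact (1 ≤ q)] : LqField Ω q →L[ℝ] Lsigma Ω q :=
  if h : ∃ P, IsHelmholtzProjection Ω q P then h.choose else 0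

theorem helmholtz_spec {Ω : Set E3} {q : ℝ≥0∞} [Fact (1 ≤ q)]
    (h : ∃ P, IsHelmholtzProjection Ω q P) : IsHelmholtzProjection Ω q (helmholtz Ω q) := by
  rw [helmholtz, dif_pos h]
  exact h.choose_spec

/-- A rigid body with a cavity that is completely filled by a fluid of density one. The
coordinates have their origin at the center of mass of the whole system (solid and fluid), and
the coordinate axes are principal axes of inertia of the whole system. The mass distribution of
the solid is an arbitrary finite measure with bounded support outside the cavity which, as for
every three-dimensional solid, is not concentrated on a line through the origin. -/
structure FluidFilledBody where
  /-- the cavity, that is the fluid domain -/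
  Ω : Set E3
  isOpen : IsOpen Ω
  isConnected : IsConnected Ω
  isBounded : Bornology.IsBounded Ω
  hasC3Boundary : HasC3Boundary Ω
  /-- the mass distribution of the solid -/
  solid : Measure E3
  solid_finite : IsFiniteMeasure solid
  solid_bounded : ∃ R : ℝ, solid (Metric.closedBall 0 R)ᶜ = 0
  solid_outside : solid Ω = 0
  solid_not_line : ∀ a : E3, solid ((Submodule.span ℝ {a} : Submodule ℝ E3) : Set E3)ᶜ ≠ 0
  center_of_mass : (∫ x in Ω, x) + ∫ x, x ∂solid = 0
  principal_axes : ∀ i j : Fin 3, i ≠ j →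
    (∫ x in Ω, x i * x j) + ∫ x, x i * x j ∂solid = 0

namespace FluidFilledBody

variable (S : FluidFilledBody)

/-- The inertia tensor of the whole system, as a matrix. It is diagonal, since the coordinate
axes are principal axes; its diagonal entries are the central moments of inertia. -/
def inertiaMatrix : Matrix (Fin 3) (Fin 3) ℝ := fun i j =>
  (∫ x in S.Ω, ((if i = j then ‖x‖ ^ 2 else 0) - x i * x j)) +
    ∫ x, ((if i = j then ‖x‖ ^ 2 else 0) - x i * x j) ∂S.solid

/-- The inertia tensor `𝕀` of the whole system as an operator on `ℝ³`. -/
def inertia : E3 →L[ℝ] E3 := Matrix.toEuclideanCLM (𝕜 := ℝ) S.inertiaMatrix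

/-- The inverse `𝕀⁻¹` of the inertia tensor. -/
def inertiaInv : E3 →L[ℝ] E3 := Matrix.toEuclideanCLM (𝕜 := ℝ) S.inertiaMatrix⁻¹

theorem memLp_of_continuous {f : E3 → E3} (hf : Continuous f) (p : ℝ≥0∞) :
    MemLp f p (volume.restrict S.Ω) := by
  have hK : IsCompact (closure S.Ω) := S.isBounded.isCompact_closure
  haveI : IsFiniteMeasure (volume.restrict S.Ω) := ⟨by
    rw [Measure.restrict_apply_univ]
    exact S.isBounded.measure_lt_top⟩
  obtain ⟨C, hC⟩ := hK.exists_bound_of_continuousOn hf.continuousOn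
  exact MemLp.of_bound hf.aestronglyMeasurable C
    ((ae_restrict_iff' S.isOpen.measurableSet).2
      (Eventually.of_forall fun x hx => hC x (subset_closure hx)))

/-- The field `x ↦ x × a` on `Ω`, as an element of `L_q(Ω)³` that depends linearly on `a`. -/
def rotation (q : ℝ≥0∞) [Fact (1 ≤ q)] : E3 →L[ℝ] LqField S.Ω q :=
  LinearMap.toContinuousLinearMap
    { toFun := fun a => (S.memLp_of_continuous (f := fun x => cross x a)
        ((crossL.flip a).continuous) q).toLp (fun x => cross x a)
      map_add' := fun a b => by
        rw [← MemLp.toLp_add]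
        congr 1
        funext x
        exact map_add (crossL x) a b
      map_smul' := fun r a => by
        rw [RingHom.id_apply, ← MemLp.toLp_const_smul]
        congr 1
        funext x
        exact map_smul (crossL x) r a }

theorem exists_angularMomentum (q : ℝ≥0∞) [hq : Fact (1 ≤ q)] :
    ∃ T : LqField S.Ω q →L[ℝ] E3, ∀ v, T v = ∫ x in S.Ω, cross x (v x) := by
  haveI hc := ENNReal.HolderConjugate.conjExponent hq.out
  haveI hc' : ENNReal.HolderConjugate q.conjExponent q := hc.symm
  haveI : Fact (1 ≤ q.conjExponent) := ⟨ENNReal.HolderConjugate.one_le _ q⟩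
  have hid := S.memLp_of_continuous continuous_id q.conjExponent
  refine ⟨crossL.lpPairing (volume.restrict S.Ω) q.conjExponent q (hid.toLp id), fun v => ?_⟩
  rw [ContinuousLinearMap.lpPairing_eq_integral]
  refine integral_congr_ae ?_
  filter_upwards [hid.coeFn_toLp] with x hx
  rw [hx]
  rfl

/-- The angular momentum functional `v ↦ ∫_Ω x × v dx` on `L_{q,σ}(Ω)`. -/
def angularMomentum (q : ℝ≥0∞) [Fact (1 ≤ q)] : Lsigma S.Ω q →L[ℝ] E3 where
  toFun v := ∫ x in S.Ω, cross x ((v : LqField S.Ω q) x)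
  map_add' v w := by
    obtain ⟨T, hT⟩ := S.exists_angularMomentum q
    simp only [← hT, Submodule.coe_add, map_add]
  map_smul' c v := by
    obtain ⟨T, hT⟩ := S.exists_angularMomentum q
    simp only [← hT, Submodule.coe_smul, map_smul, RingHom.id_apply]
  cont := by
    obtain ⟨T, hT⟩ := S.exists_angularMomentum q
    simp only [← hT]
    exact T.continuous.comp continuous_subtype_val

/-- The map `a ↦ ℙ(x × a)` from `ℝ³` to `L_{q,σ}(Ω)`. -/
def projRotation (q : ℝ≥0∞) [Fact (1 ≤ q)] : E3 →L[ℝ] Lsigma S.Ω q :=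
  helmholtz S.Ω q ∘L S.rotation q

/-- The operator `K v = ℙ(x × 𝕀⁻¹ ∫_Ω (x × v) dx)` on `L_{q,σ}(Ω)`. -/
def K (q : ℝ≥0∞) [Fact (1 ≤ q)] : Lsigma S.Ω q →L[ℝ] Lsigma S.Ω q :=
  S.projRotation q ∘L S.inertiaInv ∘L S.angularMomentum q

/-- The operator `C` on `L_{q,σ}(Ω)`, defined by `I + C = (I + K)⁻¹`. -/
def C (q : ℝ≥0∞) [Fact (1 ≤ q)] : Lsigma S.Ω q →L[ℝ] Lsigma S.Ω q :=
  Ring.inverse (1 + S.K q) - 1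

/-- The Banach space `X₀ = L_{q,σ}(Ω) × ℝ³`. -/
abbrev X0 (q : ℝ≥0∞) [Fact (1 ≤ q)] : Type := Lsigma S.Ω q × E3

/-- The operator
`E (v, a) = (v + ℙ(x × 𝕀⁻¹ ∫_Ω (x × v) dx) - ℙ(x × a), 𝕀 a)` on `X₀`. -/
def E (q : ℝ≥0∞) [Fact (1 ≤ q)] : S.X0 q →L[ℝ] S.X0 q where
  toFun u := (u.1 + S.projRotation q (S.inertiaInv (S.angularMomentum q u.1))
    - S.projRotation q u.2, S.inertia u.2)
  map_add' u w := by
    ext1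
    · simp only [Prod.fst_add, Prod.snd_add, map_add]
      abel
    · simp only [Prod.snd_add, map_add]
  map_smul' c u := by
    ext1
    · simp only [Prod.smul_fst, Prod.smul_snd, map_smul, RingHom.id_apply, smul_add, smul_sub]
    · simp only [Prod.smul_snd, map_smul, RingHom.id_apply]
  cont := by fun_prop

end FluidFilledBody

end

open MeasureTheory Set Filter Topology
open scoped ENNReal ContDiff

noncomputable section

/-! Write R = ℙ(x × ·) and L for the angular momentum, so that K = R𝕀⁻¹L factors through ℝ³.
Inverting I + K reduces (Sherman–Morrison–Woodbury) to inverting N = 𝕀 + LR on ℝ³, and then C =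
-RN⁻¹L. This gives the finite rank and compactness of C, and E is inverted by back substitution.

N is invertible because it is positive definite. The form of 𝕀 at b is the squared L₂(Ω) norm of x ×
b plus the solid's share, which is positive since the solid does not lie on a line
(`norm_rotation_sq_lt`). The form of LR at b is minus the squared norm of an orthogonal projection
of x × b, so it cannot cancel more than the fluid's share. For q ≠ 2 this needs the Helmholtz
projections on L_q and L₂ to agree on x × b (`IsHelmholtzProjection.ae_eq_starProjection`).

For q = 2, R = -L*, so C = L*N⁻¹L is symmetric and nonnegative.

Existence of the Helmholtz projection is never needed: without one, R = 0, C = 0 and N = 𝕀. -/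

/-! ### Cross product identities and positive operators on ℝ³. -/

theorem inner_cross_left (a x v : E3) : inner ℝ a (cross x v) = -inner ℝ v (cross x a) := by
  simp [cross, crossProduct, PiLp.inner_apply, Fin.sum_univ_three]
  ring

theorem inner_cross_cross (x b c : E3) :
    inner ℝ (cross x b) (cross x c) =
      ∑ i, ∑ j, c i * b j * ((if i = j then ‖x‖ ^ 2 else 0) - x i * x j) := by
  simp [cross, crossProduct, PiLp.inner_apply, Fin.sum_univ_three, EuclideanSpace.norm_sq_eq]
  ring

theorem mem_span_of_cross_eq_zero {x b : E3} (hb : b ≠ 0) (h : cross x b = 0) :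
    x ∈ Submodule.span ℝ {b} := by
  have h0 := congrArg (fun v : E3 => v 0) h
  have h1 := congrArg (fun v : E3 => v 1) h
  have h2 := congrArg (fun v : E3 => v 2) h
  simp [cross, crossProduct] at h0 h1 h2
  have hb2 : ‖b‖ ^ 2 ≠ 0 := by positivity
  rw [EuclideanSpace.norm_sq_eq] at hb2
  simp only [Fin.sum_univ_three, Real.norm_eq_abs, sq_abs] at hb2
  refine Submodule.mem_span_singleton.2
    ⟨(x 0 * b 0 + x 1 * b 1 + x 2 * b 2) / (b 0 ^ 2 + b 1 ^ 2 + b 2 ^ 2), ?_⟩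
  ext i
  simp only [PiLp.smul_apply, smul_eq_mul]
  rw [div_mul_eq_mul_div, div_eq_iff hb2]
  -- Components of b × (x × b) = |b|² x - (x·b) b.
  fin_cases i <;> simp
  · linear_combination b 2 * h1 - b 1 * h2
  · linear_combination b 0 * h2 - b 2 * h0
  · linear_combination b 1 * h0 - b 0 * h1

theorem continuous_cross (a : E3) : Continuous fun x : E3 => cross x a :=
  (crossL.flip a).continuous

/-- The moments of inertia of a mass distribution, as a bilinear form. -/
theorem integral_inner_cross_cross {μ : Measure E3}
    (hμ : ∀ f : E3 → ℝ, Continuous f → Integrable f μ) (b c : E3) :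
    ∫ x, inner ℝ (cross x b) (cross x c) ∂μ =
      ∑ i, ∑ j, c i * b j * ∫ x, ((if i = j then ‖x‖ ^ 2 else 0) - x i * x j) ∂μ := by
  have hint (i j : Fin 3) :
      Integrable (fun x : E3 => c i * b j * ((if i = j then ‖x‖ ^ 2 else 0) - x i * x j)) μ := by
    apply hμ
    split_ifs <;> fun_prop
  simp only [inner_cross_cross]
  rw [integral_finsetSum _ fun i _ => integrable_finsetSum _ fun j _ => hint i j]
  refine Finset.sum_congr rfl fun i _ => ?_
  rw [integral_finsetSum _ fun j _ => hint i j]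
  exact Finset.sum_congr rfl fun j _ => integral_const_mul _ _

theorem ContinuousLinearMap.isUnit_of_inner_pos {T : E3 →L[ℝ] E3}
    (h : ∀ b ≠ 0, 0 < inner ℝ b (T b)) : IsUnit T := by
  have hinj : Function.Injective T.toLinearMap := by
    refine (injective_iff_map_eq_zero _).2 fun b hb => ?_
    by_contra hne
    have := h b hne
    rw [show T b = 0 from hb, inner_zero_right] at this
    exact this.false
  exact ContinuousLinearMap.isUnit_iff_bijective.2
    ⟨hinj, LinearMap.injective_iff_surjective.1 hinj⟩

/-! ### The inertia tensor and the angular momentum. -/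

namespace FluidFilledBody

variable (S : FluidFilledBody)

instance isFiniteMeasure_restrict : IsFiniteMeasure (volume.restrict S.Ω) :=
  ⟨by
    rw [Measure.restrict_apply_univ]
    exact S.isBounded.measure_lt_top⟩

theorem integrable_solid (f : E3 → ℝ) (hf : Continuous f) : Integrable f S.solid := by
  have := S.solid_finite
  obtain ⟨R, hR⟩ := S.solid_bounded
  obtain ⟨M, hM⟩ := (isCompact_closedBall (0 : E3) R).exists_bound_of_continuousOn hf.continuousOn
  refine Integrable.of_bound hf.aestronglyMeasurable M ?_
  filter_upwards [mem_ae_iff.2 hR] with x hx using hM x hx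

theorem integrable_fluid (f : E3 → ℝ) (hf : Continuous f) :
    Integrable f (volume.restrict S.Ω) :=
  (hf.continuousOn.integrableOn_compact S.isBounded.isCompact_closure).mono_set subset_closure

theorem inner_inertia (b c : E3) :
    inner ℝ c (S.inertia b) = (∫ x in S.Ω, inner ℝ (cross x b) (cross x c)) +
      ∫ x, inner ℝ (cross x b) (cross x c) ∂S.solid := by
  rw [integral_inner_cross_cross S.integrable_fluid, integral_inner_cross_cross S.integrable_solid,
    inertia, Matrix.inner_toEuclideanCLM]
  simp only [dotProduct, Matrix.mulVec, inertiaMatrix, ← Finset.sum_add_distrib, Finset.mul_sum]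
  exact Finset.sum_congr rfl fun i _ => Finset.sum_congr rfl fun j _ => by ring

/-- If the integral vanished, x × b = 0 would hold almost everywhere for the solid, concentrating it
on the line spanned by b. -/
theorem solid_inertia_pos {b : E3} (hb : b ≠ 0) :
    0 < ∫ x, inner ℝ (cross x b) (cross x b) ∂S.solid := by
  have hint := S.integrable_solid (fun x => inner ℝ (cross x b) (cross x b))
    ((continuous_cross b).inner (continuous_cross b))
  have h0 : 0 ≤ fun x : E3 => inner ℝ (cross x b) (cross x b) := fun x => real_inner_self_nonneg
  refine (integral_nonneg h0).lt_of_ne' fun h => S.solid_not_line b ?_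
  rw [integral_eq_zero_iff_of_nonneg h0 hint] at h
  refine mem_ae_iff.1 ?_
  filter_upwards [h] with x hx
  exact mem_span_of_cross_eq_zero hb (inner_self_eq_zero.1 hx)

theorem rotation_coeFn (q : ℝ≥0∞) [Fact (1 ≤ q)] (a : E3) :
    S.rotation q a =ᵐ[volume.restrict S.Ω] fun x => cross x a :=
  (S.memLp_of_continuous (continuous_cross a) q).coeFn_toLp

theorem inner_rotation (b c : E3) :
    inner ℝ (S.rotation 2 b) (S.rotation 2 c) =
      ∫ x in S.Ω, inner ℝ (cross x b) (cross x c) := by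
  rw [L2.inner_def]
  refine integral_congr_ae ?_
  filter_upwards [S.rotation_coeFn 2 b, S.rotation_coeFn 2 c] with x hb hc
  rw [hb, hc]

theorem inner_inertia_comm (b c : E3) : inner ℝ c (S.inertia b) = inner ℝ b (S.inertia c) := by
  simp only [inner_inertia, real_inner_comm]

/-- The gap is the moment of inertia of the solid; it is what keeps the effective inertia positive.
-/
theorem norm_rotation_sq_lt {b : E3} (hb : b ≠ 0) :
    ‖S.rotation 2 b‖ ^ 2 < inner ℝ b (S.inertia b) := by
  rw [inner_inertia, ← inner_rotation, real_inner_self_eq_norm_sq]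
  exact lt_add_of_pos_right _ (S.solid_inertia_pos hb)

theorem isUnit_inertia : IsUnit S.inertia :=
  ContinuousLinearMap.isUnit_of_inner_pos fun _ hb =>
    (sq_nonneg _).trans_lt (S.norm_rotation_sq_lt hb)

theorem isUnit_inertiaMatrix : IsUnit S.inertiaMatrix.det := by
  rw [← Matrix.isUnit_iff_isUnit_det]
  exact (MulEquiv.isUnit_map (Matrix.toEuclideanCLM (n := Fin 3) (𝕜 := ℝ))).1 S.isUnit_inertia

theorem inertia_inertiaInv (a : E3) : S.inertia (S.inertiaInv a) = a := by
  have h : S.inertia * S.inertiaInv = 1 := by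
    rw [inertia, inertiaInv, ← map_mul, Matrix.mul_nonsing_inv _ S.isUnit_inertiaMatrix, map_one]
  exact congrArg (· a) h

theorem inertiaInv_inertia (a : E3) : S.inertiaInv (S.inertia a) = a := by
  have h : S.inertiaInv * S.inertia = 1 := by
    rw [inertia, inertiaInv, ← map_mul, Matrix.nonsing_inv_mul _ S.isUnit_inertiaMatrix, map_one]
  exact congrArg (· a) h

/-- The angular momentum is minus the transpose of `rotation`, by antisymmetry of the triple
product. -/
theorem inner_angularMomentum {q : ℝ≥0∞} [Fact (1 ≤ q)] (v : Lsigma S.Ω q) (a : E3) :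
    inner ℝ a (S.angularMomentum q v) =
      -∫ x in S.Ω, inner ℝ ((v : LqField S.Ω q) x) (cross x a) := by
  have hint : Integrable (fun x => cross x ((v : LqField S.Ω q) x)) (volume.restrict S.Ω) := by
    have := ENNReal.HolderConjugate.conjExponent (Fact.out : 1 ≤ q)
    exact memLp_one_iff_integrable.1 (crossL.flip.memLp_of_bilin 1 (Lp.memLp v.1)
      (S.memLp_of_continuous continuous_id q.conjExponent))
  change inner ℝ a (∫ x in S.Ω, cross x ((v : LqField S.Ω q) x)) = _
  rw [← integral_inner hint, ← integral_neg]
  exact integral_congr_ae (Eventually.of_forall fun x => inner_cross_left a x _)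

end FluidFilledBody
end

noncomputable section

/-! ### Consistency of the Helmholtz projections on L_q and L₂. -/

section Restrict

variable {Ω : Set E3}

theorem IsWeakGradient.congr {φ φ' : E3 → ℝ} {g g' : E3 → E3} (h : IsWeakGradient Ω φ g)
    (hφ : φ =ᵐ[volume.restrict Ω] φ') (hg : g =ᵐ[volume.restrict Ω] g') :
    IsWeakGradient Ω φ' g' := by
  intro ψ h1 h2 h3
  have e1 : ∫ x in Ω, φ' x • gradient ψ x = ∫ x in Ω, φ x • gradient ψ x := by
    refine integral_congr_ae ?_
    filter_upwards [hφ] with x hx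
    rw [hx]
  have e2 : ∫ x in Ω, ψ x • g' x = ∫ x in Ω, ψ x • g x := by
    refine integral_congr_ae ?_
    filter_upwards [hg] with x hx
    rw [hx]
  rw [e1, e2, h ψ h1 h2 h3]

theorem inner_gradient (ψ : E3 → ℝ) (x v : E3) :
    inner ℝ v (gradient ψ x) = fderiv ℝ ψ x v := by
  rw [gradient, real_inner_comm, InnerProductSpace.toDual_symm_apply]

/-- The gradient of a test function is its weak gradient. -/
theorem isWeakGradient_gradient {χ : E3 → ℝ} (h1 : ContDiff ℝ ∞ χ) (h2 : HasCompactSupport χ) :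
    IsWeakGradient Ω χ (gradient χ) := by
  intro ψ g1 g2 g3
  have hcont {f : E3 → ℝ} (hf : ContDiff ℝ ∞ f) : Continuous (gradient f) :=
    (InnerProductSpace.toDual ℝ E3).symm.continuous.comp (hf.continuous_fderiv (by simp))
  have i1 : Integrable (fun x => χ x • gradient ψ x) :=
    (h1.continuous.smul (hcont g1)).integrable_of_hasCompactSupport h2.smul_right
  have i2 : Integrable (fun x => ψ x • gradient χ x) :=
    (g1.continuous.smul (hcont h1)).integrable_of_hasCompactSupport g2.smul_right
  have hz (x : E3) (hx : x ∉ Ω) : ψ x = 0 := image_eq_zero_of_notMem_tsupport fun h => hx (g3 h)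
  have hz' (x : E3) (hx : x ∉ Ω) : gradient ψ x = 0 := by
    have : fderiv ℝ ψ x = 0 := by
      by_contra hne
      exact hx (g3 (support_fderiv_subset ℝ hne))
    rw [gradient, this, map_zero]
  -- Since ψ is supported in Ω, both integrals extend to the whole space, where integration by parts
  -- has no boundary term.
  rw [setIntegral_eq_integral_of_forall_compl_eq_zero fun x hx => by rw [hz' x hx, smul_zero],
    setIntegral_eq_integral_of_forall_compl_eq_zero fun x hx => by rw [hz x hx, zero_smul]]
  refine ext_inner_left ℝ fun v => ?_
  rw [inner_neg_right, ← integral_inner i1, ← integral_inner i2]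
  simp only [inner_smul_right, inner_gradient]
  have := integral_mul_fderiv_eq_neg_fderiv_mul_of_integrable (μ := (volume : Measure E3))
    (f := χ) (g := ψ) (v := v) (by
      have := i2.const_inner (𝕜 := ℝ) v
      simpa only [inner_smul_right, inner_gradient, mul_comm] using this) (by
      have := i1.const_inner (𝕜 := ℝ) v
      simpa only [inner_smul_right, inner_gradient] using this)
    ((h1.continuous.mul g1.continuous).integrable_of_hasCompactSupport h2.mul_right)
    (fun x _ => (h1.differentiable (by simp)) x) (fun x _ => (g1.differentiable (by simp)) x)
  rw [this]
  simp only [mul_comm]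

theorem conjExponent_le_two {q : ℝ≥0∞} (h : 2 ≤ q) : q.conjExponent ≤ 2 := by
  have h1 : (1 : ℝ≥0∞) ≤ q - 1 := by
    calc (1 : ℝ≥0∞) = 2 - 1 := ENNReal.eq_sub_of_add_eq (by simp) one_add_one_eq_two
      _ ≤ q - 1 := tsub_le_tsub_right h 1
  calc q.conjExponent = 1 + (q - 1)⁻¹ := rfl
    _ ≤ 1 + 1 := by gcongr; exact ENNReal.inv_le_one.2 h1
    _ = 2 := one_add_one_eq_two

theorem two_le_conjExponent {q : ℝ≥0∞} (h : q ≤ 2) : 2 ≤ q.conjExponent := by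
  have h1 : q - 1 ≤ (1 : ℝ≥0∞) := by
    rw [tsub_le_iff_right, one_add_one_eq_two]
    exact h
  calc (2 : ℝ≥0∞) = 1 + 1 := one_add_one_eq_two.symm
    _ ≤ 1 + (q - 1)⁻¹ := by gcongr; exact ENNReal.one_le_inv.2 h1
    _ = q.conjExponent := rfl

theorem conjExponent_two : (2 : ℝ≥0∞).conjExponent = 2 :=
  le_antisymm (conjExponent_le_two le_rfl) (two_le_conjExponent le_rfl)

/-- The `L₂` fields that are gradients of functions in `H¹₂(Ω)`. -/
def gradients (Ω : Set E3) : Submodule ℝ (LqField Ω 2) :=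
  Submodule.span ℝ {g | ∃ φ : Lp ℝ 2 (volume.restrict Ω), IsWeakGradient Ω φ g}

instance hasOrthogonalProjection_orthogonal_gradients :
    (gradients Ω)ᗮ.HasOrthogonalProjection :=
  have := (Submodule.isClosed_orthogonal (gradients Ω)).completeSpace_coe
  Submodule.HasOrthogonalProjection.ofCompleteSpace _

theorem mem_orthogonal_gradients {u : LqField Ω 2}
    (h : ∀ (φ : Lp ℝ 2 (volume.restrict Ω)) (g : LqField Ω 2), IsWeakGradient Ω φ g →
      inner ℝ u g = 0) : u ∈ (gradients Ω)ᗮ := by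
  rw [Submodule.mem_orthogonal']
  intro g hg
  induction hg using Submodule.span_induction with
  | mem g hg => exact h _ g hg.choose_spec
  | zero => exact inner_zero_right u
  | add g g' _ _ h1 h2 => rw [inner_add_right, h1, h2, add_zero]
  | smul c g _ h1 => rw [inner_smul_right, h1, mul_zero]

theorem integral_inner_eq_zero_of_mem_orthogonal {u : LqField Ω 2} (hu : u ∈ (gradients Ω)ᗮ)
    {φ : E3 → ℝ} {g : E3 → E3} (h : IsWeakGradient Ω φ g)
    (hφ : MemLp φ 2 (volume.restrict Ω)) (hg : MemLp g 2 (volume.restrict Ω)) :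
    ∫ x in Ω, inner ℝ (u x) (g x) = 0 := by
  have hm : hg.toLp g ∈ gradients Ω :=
    Submodule.subset_span ⟨hφ.toLp φ, h.congr hφ.coeFn_toLp.symm hg.coeFn_toLp.symm⟩
  rw [← (Submodule.mem_orthogonal' _ _).1 hu _ hm, L2.inner_def]
  refine integral_congr_ae ?_
  filter_upwards [hg.coeFn_toLp] with x hx
  rw [hx]

variable [IsFiniteMeasure (volume.restrict Ω)] {q : ℝ≥0∞} [Fact (1 ≤ q)]

/-- The embedding of `L₂(Ω)³` into `L_q(Ω)³` for `q ≤ 2`. -/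
theorem exists_embedding (hq : q ≤ 2) :
    ∃ J : LqField Ω 2 →L[ℝ] LqField Ω q, ∀ u, J u =ᵐ[volume.restrict Ω] u := by
  -- The Hölder constant |Ω|^(1/q - 1/2); its exponent is nonnegative because q ≤ 2.
  set M := (volume.restrict Ω univ) ^ (1 / q.toReal - 1 / (2 : ℝ≥0∞).toReal) with hM
  have hMtop : M ≠ ⊤ := by
    refine ENNReal.rpow_ne_top_of_nonneg ?_ (measure_ne_top _ _)
    have h1 : 0 < q.toReal := ENNReal.toReal_pos
      (zero_lt_one.trans_le Fact.out).ne' (ne_top_of_le_ne_top (by simp) hq)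
    exact sub_nonneg.2 (one_div_le_one_div_of_le h1 (ENNReal.toReal_mono (by simp) hq))
  let J : LqField Ω 2 →ₗ[ℝ] LqField Ω q :=
    { toFun := fun u => ((Lp.memLp u).mono_exponent hq).toLp u
      map_add' := fun u v => by
        rw [← MemLp.toLp_add]
        exact MemLp.toLp_congr _ _ (Lp.coeFn_add u v)
      map_smul' := fun c u => by
        rw [RingHom.id_apply, ← MemLp.toLp_const_smul]
        exact MemLp.toLp_congr _ _ (Lp.coeFn_smul c u) }
  refine ⟨J.mkContinuous M.toReal fun u => ?_,
    fun u => ((Lp.memLp u).mono_exponent hq).coeFn_toLp⟩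
  change ‖((Lp.memLp u).mono_exponent hq).toLp u‖ ≤ _
  rw [Lp.norm_toLp, Lp.norm_def, ← ENNReal.toReal_mul]
  refine ENNReal.toReal_mono (ENNReal.mul_ne_top hMtop (Lp.eLpNorm_ne_top u)) ?_
  rw [mul_comm]
  exact eLpNorm_le_eLpNorm_mul_rpow_measure_univ hq (Lp.aestronglyMeasurable u)

/-- The Helmholtz projection of a field in `L₂ ∩ L_q` is its orthogonal projection onto the
complement of the gradients in `L₂`. -/
theorem IsHelmholtzProjection.ae_eq_starProjection {P : LqField Ω q →L[ℝ] Lsigma Ω q}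
    (hP : IsHelmholtzProjection Ω q P) {f : LqField Ω q} {f₂ : LqField Ω 2}
    (hf : f =ᵐ[volume.restrict Ω] f₂) :
    (P f : LqField Ω q) =ᵐ[volume.restrict Ω] (gradients Ω)ᗮ.starProjection f₂ := by
  rcases le_total 2 q with hq | hq
  -- For q ≥ 2, `P f` and f - `P f` both lie in L₂. The former is orthogonal to gradients because
  -- H¹₂ embeds in H¹_{q'}, as q' ≤ 2; the latter is a gradient. This decomposition is the
  -- orthogonal one.
  · have hmem := (Lp.memLp (P f : LqField Ω q)).mono_exponent hq
    set u := hmem.toLp _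
    have hcoe : u =ᵐ[volume.restrict Ω] (P f : LqField Ω q) := hmem.coeFn_toLp
    have hu1 : u ∈ (gradients Ω)ᗮ := by
      refine mem_orthogonal_gradients fun φ g h => ?_
      have hφ := (Lp.memLp φ).mono_exponent (conjExponent_le_two hq)
      have hg := (Lp.memLp g).mono_exponent (conjExponent_le_two hq)
      rw [L2.inner_def, ← (P f).2.2 (hφ.toLp φ) (hg.toLp g)
        (h.congr hφ.coeFn_toLp.symm hg.coeFn_toLp.symm)]
      refine integral_congr_ae ?_
      filter_upwards [hcoe, hg.coeFn_toLp] with x h1 h2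
      rw [h1, h2]
    have hu2 : f₂ - u ∈ gradients Ω := by
      obtain ⟨φ, hφ⟩ := (hP.2 (f - (P f : LqField Ω q))).1 (by rw [map_sub, hP.1, sub_self])
      have hφ2 := (Lp.memLp φ).mono_exponent hq
      refine Submodule.subset_span ⟨hφ2.toLp φ, hφ.congr hφ2.coeFn_toLp.symm ?_⟩
      filter_upwards [Lp.coeFn_sub f (P f : LqField Ω q), Lp.coeFn_sub f₂ u, hf, hcoe]
        with x h1 h2 h3 h4
      rw [h1, h2, Pi.sub_apply, Pi.sub_apply, h3, h4]
    rw [Submodule.eq_starProjection_of_mem_orthogonal hu1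
      (Submodule.le_orthogonal_orthogonal _ hu2)]
    exact hcoe.symm
  -- For q ≤ 2 the argument runs the other way: the orthogonal projection u is solenoidal in L_q,
  -- because H¹_{q'} embeds in H¹₂.
  · obtain ⟨J, hJ⟩ := exists_embedding (Ω := Ω) hq
    set u := (gradients Ω)ᗮ.starProjection f₂
    have hu1 : u ∈ (gradients Ω)ᗮ := Submodule.starProjection_apply_mem _ _
    have hint (h : E3 → E3) : ∫ x in Ω, inner ℝ (J u x) (h x) = ∫ x in Ω, inner ℝ (u x) (h x) := by
      refine integral_congr_ae ?_
      filter_upwards [hJ u] with x hx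
      rw [hx]
    have hσ : J u ∈ Lsigma Ω q := by
      refine ⟨fun ψ h1 h2 h3 => ?_, fun φ g h => ?_⟩
      · rw [hint]
        exact integral_inner_eq_zero_of_mem_orthogonal hu1 (isWeakGradient_gradient h1 h2)
          ((h1.continuous.memLp_of_hasCompactSupport h2).restrict Ω) (memLp_gradient h1 h2 2)
      · rw [hint]
        exact integral_inner_eq_zero_of_mem_orthogonal hu1 h
          ((Lp.memLp φ).mono_exponent (two_le_conjExponent hq))
          ((Lp.memLp g).mono_exponent (two_le_conjExponent hq))
    -- f₂ - u is known only to lie in the closure of the gradients; continuity of P ∘ J is what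
    -- annihilates it.
    have hker : (gradients Ω)ᗮᗮ ≤ (P ∘L J).ker := by
      rw [Submodule.orthogonal_orthogonal_eq_closure]
      refine Submodule.topologicalClosure_minimal _ (Submodule.span_le.2 ?_)
        (P ∘L J).isClosed_ker
      rintro g ⟨φ, h⟩
      have hφ := (Lp.memLp φ).mono_exponent hq
      exact (hP.2 _).2 ⟨hφ.toLp φ, h.congr hφ.coeFn_toLp.symm (hJ g).symm⟩
    have hJf : J f₂ = f := Lp.ext ((hJ f₂).trans hf.symm)
    have hPf : (P f : LqField Ω q) = J u := by
      have h0 : P (J (f₂ - u)) = 0 :=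
        hker (Submodule.sub_starProjection_mem_orthogonal (K := (gradients Ω)ᗮ) f₂)
      rw [map_sub, map_sub, hJf, sub_eq_zero] at h0
      rw [h0]
      exact congrArg Subtype.val (hP.1 ⟨J u, hσ⟩)
    rw [hPf]
    exact hJ u

end Restrict
end

noncomputable section

/-! ### The effective inertia N. -/

namespace FluidFilledBody

variable (S : FluidFilledBody) (q : ℝ≥0∞) [Fact (1 ≤ q)]

/-- For every exponent `q`, the form `(b, c) ↦ ∫_Ω (ℙ(x × b) | x × c)` is the Gram form of an
orthogonal projection in `L₂`. -/
theorem inner_angularMomentum_projRotation (h : ∃ P, IsHelmholtzProjection S.Ω q P) (b c : E3) :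
    inner ℝ c (S.angularMomentum q (S.projRotation q b)) =
      -inner ℝ ((gradients S.Ω)ᗮ.starProjection (S.rotation 2 b)) (S.rotation 2 c) := by
  rw [inner_angularMomentum, L2.inner_def]
  refine congrArg Neg.neg (integral_congr_ae ?_)
  filter_upwards [S.rotation_coeFn 2 c, (helmholtz_spec h).ae_eq_starProjection
    ((S.rotation_coeFn q b).trans (S.rotation_coeFn 2 b).symm)] with x h1 h2
  rw [h1, ← h2]
  rfl

/-- When `Ω` has no Helmholtz projection on `L_q`, `helmholtz` is `0` by definition. -/
theorem projRotation_eq_zero (h : ¬∃ P, IsHelmholtzProjection S.Ω q P) :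
    S.projRotation q = 0 := by
  rw [projRotation, helmholtz, dif_neg h, ContinuousLinearMap.zero_comp]

/-- The operator `a ↦ 𝕀 a + ∫_Ω x × ℙ(x × a) dx` on `ℝ³`. -/
def effectiveInertia : E3 →L[ℝ] E3 :=
  S.inertia + S.angularMomentum q ∘L S.projRotation q

theorem effectiveInertia_apply (b : E3) : S.effectiveInertia q b =
    S.inertia b + S.angularMomentum q (S.projRotation q b) := rfl

theorem inner_effectiveInertia_comm (b c : E3) :
    inner ℝ c (S.effectiveInertia q b) = inner ℝ b (S.effectiveInertia q c) := by
  simp only [effectiveInertia_apply, inner_add_right, S.inner_inertia_comm b c]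
  by_cases h : ∃ P, IsHelmholtzProjection S.Ω q P
  · rw [S.inner_angularMomentum_projRotation q h, S.inner_angularMomentum_projRotation q h,
      Submodule.inner_starProjection_left_eq_right,
      real_inner_comm ((gradients S.Ω)ᗮ.starProjection (S.rotation 2 c))]
  · simp [S.projRotation_eq_zero q h]

/-- The effective inertia exceeds the moment of inertia of the solid, which is positive. -/
theorem inner_effectiveInertia_pos {b : E3} (hb : b ≠ 0) :
    0 < inner ℝ b (S.effectiveInertia q b) := by
  have hlt := S.norm_rotation_sq_lt hb
  rw [effectiveInertia_apply, inner_add_right]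
  by_cases h : ∃ P, IsHelmholtzProjection S.Ω q P
  · rw [S.inner_angularMomentum_projRotation q h]
    -- Cauchy–Schwarz together with the fact that orthogonal projections are contractions.
    have hle : inner ℝ ((gradients S.Ω)ᗮ.starProjection (S.rotation 2 b)) (S.rotation 2 b) ≤
        ‖S.rotation 2 b‖ ^ 2 := by
      rw [sq]
      exact (real_inner_le_norm _ _).trans
        (mul_le_mul_of_nonneg_right (Submodule.norm_starProjection_apply_le _ _) (norm_nonneg _))
    linarith
  · simp only [S.projRotation_eq_zero q h, zero_apply, map_zero, inner_zero_right, add_zero]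
    exact (sq_nonneg _).trans_lt hlt

theorem isUnit_effectiveInertia : IsUnit (S.effectiveInertia q) :=
  ContinuousLinearMap.isUnit_of_inner_pos fun _ hb => S.inner_effectiveInertia_pos q hb

/-- The inverse of the effective inertia. -/
def effectiveInertiaInv : E3 →L[ℝ] E3 := Ring.inverse (S.effectiveInertia q)

theorem effectiveInertia_effectiveInertiaInv (a : E3) :
    S.effectiveInertia q (S.effectiveInertiaInv q a) = a :=
  congrArg (· a) (Ring.mul_inverse_cancel _ (S.isUnit_effectiveInertia q))

theorem effectiveInertiaInv_effectiveInertia (a : E3) :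
    S.effectiveInertiaInv q (S.effectiveInertia q a) = a :=
  congrArg (· a) (Ring.inverse_mul_cancel _ (S.isUnit_effectiveInertia q))

theorem inner_effectiveInertiaInv_comm (a b : E3) :
    inner ℝ (S.effectiveInertiaInv q a) b = inner ℝ (S.effectiveInertiaInv q b) a := by
  have h := S.inner_effectiveInertia_comm q (S.effectiveInertiaInv q b)
    (S.effectiveInertiaInv q a)
  rwa [effectiveInertia_effectiveInertiaInv, effectiveInertia_effectiveInertiaInv] at h

theorem inner_effectiveInertiaInv_nonneg (a : E3) :
    0 ≤ inner ℝ (S.effectiveInertiaInv q a) a := by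
  by_cases h0 : S.effectiveInertiaInv q a = 0
  · rw [h0, inner_zero_left]
  · have h := S.inner_effectiveInertia_pos q h0
    rw [effectiveInertia_effectiveInertiaInv] at h
    exact h.le

/-- The finite-rank operator `v ↦ -ℙ(x × N⁻¹ ∫_Ω x × v dx)`, where `N` is the effective
inertia. -/
def correction : Lsigma S.Ω q →L[ℝ] Lsigma S.Ω q :=
  -(S.projRotation q ∘L S.effectiveInertiaInv q ∘L S.angularMomentum q)

/-! ### Inverting I + K and E; finite rank and compactness of C. -/

theorem K_apply (v : Lsigma S.Ω q) :
    S.K q v = S.projRotation q (S.inertiaInv (S.angularMomentum q v)) := rfl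

theorem correction_apply (v : Lsigma S.Ω q) : S.correction q v =
    -S.projRotation q (S.effectiveInertiaInv q (S.angularMomentum q v)) := rfl

/-- With b = N⁻¹Lv, the identity Lv = 𝕀b + LRb gives L(v - Rb) = 𝕀b, hence K(v - Rb) = Rb. -/
theorem one_add_K_mul : (1 + S.K q) * (1 + S.correction q) = 1 := by
  ext1 v
  set b := S.effectiveInertiaInv q (S.angularMomentum q v) with hb
  have h : S.angularMomentum q v = S.inertia b + S.angularMomentum q (S.projRotation q b) :=
    (S.effectiveInertia_effectiveInertiaInv q _).symm
  change (v + S.correction q v) + S.K q (v + S.correction q v) = v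
  rw [K_apply, correction_apply, ← hb, map_add, map_neg, h, add_neg_cancel_right,
    inertiaInv_inertia, neg_add_cancel_right]

/-- With b = 𝕀⁻¹Lv, L(v + Rb) = 𝕀b + LRb = Nb, so the correction of v + Rb is -Rb. -/
theorem mul_one_add_K : (1 + S.correction q) * (1 + S.K q) = 1 := by
  ext1 v
  set b := S.inertiaInv (S.angularMomentum q v) with hb
  have h : S.angularMomentum q v = S.inertia b := (S.inertia_inertiaInv _).symm
  change (v + S.K q v) + S.correction q (v + S.K q v) = v
  rw [K_apply, correction_apply, ← hb, map_add, h, ← effectiveInertia_apply,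
    effectiveInertiaInv_effectiveInertia, add_neg_cancel_right]

/-- The two-sided inverse rules out the default value 0 of `Ring.inverse`. -/
theorem C_eq_correction : S.C q = S.correction q := by
  rw [C, Ring.inverse_unit ⟨1 + S.K q, 1 + S.correction q, S.one_add_K_mul q, S.mul_one_add_K q⟩]
  exact add_sub_cancel_left _ _

/-- `E` as an isomorphism of `X₀`. -/
def equivE : S.X0 q ≃L[ℝ] S.X0 q :=
  ContinuousLinearEquiv.equivOfInverse (S.E q)
    (((1 + S.C q) ∘L (ContinuousLinearMap.fst ℝ (Lsigma S.Ω q) E3 +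
      S.projRotation q ∘L S.inertiaInv ∘L ContinuousLinearMap.snd ℝ (Lsigma S.Ω q) E3)).prod
      (S.inertiaInv ∘L ContinuousLinearMap.snd ℝ (Lsigma S.Ω q) E3))
    (fun u => by
      refine Prod.ext ?_ (S.inertiaInv_inertia u.2)
      change (1 + S.C q) (u.1 + S.K q u.1 - S.projRotation q u.2 +
        S.projRotation q (S.inertiaInv (S.inertia u.2))) = u.1
      rw [inertiaInv_inertia, sub_add_cancel, C_eq_correction]
      exact congrArg (· u.1) (S.mul_one_add_K q))
    (fun u => by
      refine Prod.ext ?_ (S.inertia_inertiaInv u.2)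
      set f := u.1 + S.projRotation q (S.inertiaInv u.2) with hf
      change (1 + S.K q) ((1 + S.C q) f) - S.projRotation q (S.inertiaInv u.2) = u.1
      rw [C_eq_correction, sub_eq_iff_eq_add, ← hf]
      exact congrArg (· f) (S.one_add_K_mul q))

theorem finiteDimensional_range_C : FiniteDimensional ℝ (LinearMap.range (S.C q).toLinearMap) := by
  have hle : LinearMap.range (S.C q).toLinearMap ≤
      LinearMap.range (S.projRotation q).toLinearMap := by
    rintro _ ⟨v, rfl⟩
    rw [C_eq_correction]
    exact ⟨-S.effectiveInertiaInv q (S.angularMomentum q v), map_neg _ _⟩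
  exact Submodule.finiteDimensional_of_le hle

theorem isCompactOperator_C : IsCompactOperator (S.C q) := by
  have h : IsCompactOperator (S.projRotation q) := isCompactOperator_of_locallyCompactSpace_rng _
  rw [C_eq_correction]
  exact (h.comp_clm (S.effectiveInertiaInv q ∘L S.angularMomentum q)).neg

/-! ### Symmetry and positivity for q = 2. -/

/-- This is R = -L*: the orthogonal projection moves onto v, which it fixes, and the triple product
does the rest. -/
theorem inner_projRotation_two (h : ∃ P, IsHelmholtzProjection S.Ω 2 P) (a : E3)
    (v : Lsigma S.Ω 2) :
    inner ℝ (S.projRotation 2 a) v = -inner ℝ a (S.angularMomentum 2 v) := by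
  have hP := helmholtz_spec h
  have hv : (v : LqField S.Ω 2) ∈ (gradients S.Ω)ᗮ := by
    refine mem_orthogonal_gradients fun φ g hg => ?_
    have hc : (2 : ℝ≥0∞).conjExponent ≤ 2 := conjExponent_two.le
    have hφ' := (Lp.memLp φ).mono_exponent hc
    have hg' := (Lp.memLp g).mono_exponent hc
    rw [L2.inner_def, ← v.2.2 (hφ'.toLp φ) (hg'.toLp g)
      (hg.congr hφ'.coeFn_toLp.symm hg'.coeFn_toLp.symm)]
    refine integral_congr_ae ?_
    filter_upwards [hg'.coeFn_toLp] with x hx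
    rw [hx]
  have hR : (S.projRotation 2 a : LqField S.Ω 2) =
      (gradients S.Ω)ᗮ.starProjection (S.rotation 2 a) :=
    Lp.ext (hP.ae_eq_starProjection (EventuallyEq.refl _ _))
  rw [Submodule.coe_inner, hR, Submodule.inner_starProjection_left_eq_right,
    Submodule.starProjection_eq_self_iff.2 hv, inner_angularMomentum, neg_neg, real_inner_comm,
    L2.inner_def]
  refine integral_congr_ae ?_
  filter_upwards [S.rotation_coeFn 2 a] with x hx
  rw [hx]

theorem inner_C_two (h : ∃ P, IsHelmholtzProjection S.Ω 2 P) (v w : Lsigma S.Ω 2) :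
    inner ℝ (S.C 2 v) w =
      inner ℝ (S.effectiveInertiaInv 2 (S.angularMomentum 2 v)) (S.angularMomentum 2 w) := by
  rw [C_eq_correction, correction_apply, inner_neg_left, S.inner_projRotation_two h, neg_neg]

theorem C_eq_zero (h : ¬∃ P, IsHelmholtzProjection S.Ω q P) : S.C q = 0 := by
  rw [C_eq_correction, correction, S.projRotation_eq_zero q h, ContinuousLinearMap.zero_comp,
    neg_zero]

theorem inner_C_two_comm (v w : Lsigma S.Ω 2) : inner ℝ (S.C 2 v) w = inner ℝ v (S.C 2 w) := by
  by_cases h : ∃ P, IsHelmholtzProjection S.Ω 2 P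
  · rw [real_inner_comm (S.C 2 w) v, S.inner_C_two h, S.inner_C_two h,
      inner_effectiveInertiaInv_comm]
  · simp [S.C_eq_zero 2 h]

theorem inner_C_two_nonneg (v : Lsigma S.Ω 2) : 0 ≤ inner ℝ (S.C 2 v) v := by
  by_cases h : ∃ P, IsHelmholtzProjection S.Ω 2 P
  · rw [S.inner_C_two h]
    exact S.inner_effectiveInertiaInv_nonneg 2 _
  · simp [S.C_eq_zero 2 h]

end FluidFilledBody

end

/-- For every fluid-filled rigid body and every `1 < q < ∞`: `I + K` is invertible with inverse
`I + C`; `E` is invertible on `X₀`, and its inverse is the block-triangular operator with rows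
`(I + C, (I + C) ℙ(x × 𝕀⁻¹ ·))` and `(0, 𝕀⁻¹)`; `C` has finite rank and is compact; `I + C` is
invertible on `L_{q,σ}(Ω)`; and, on `L_{2,σ}(Ω)`, `I + C` is symmetric and positive definite. -/
theorem proposition3p1 (S : FluidFilledBody) :
    (∀ (q : ℝ≥0∞) [Fact (1 ≤ q)], 1 < q → q < ⊤ →
      ((1 + S.C q) * (1 + S.K q) = 1 ∧ (1 + S.K q) * (1 + S.C q) = 1) ∧
      (∃ e : S.X0 q ≃L[ℝ] S.X0 q,
        (∀ u, e u = S.E q u) ∧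
        ∀ (f : Lsigma S.Ω q) (g : E3),
          e.symm (f, g) =
            ((1 + S.C q) f + (1 + S.C q) (helmholtz S.Ω q (S.rotation q (S.inertiaInv g))),
              S.inertiaInv g)) ∧
      FiniteDimensional ℝ (LinearMap.range (S.C q).toLinearMap) ∧
      IsCompactOperator (S.C q) ∧
      IsUnit (1 + S.C q)) ∧
    (∀ v w : Lsigma S.Ω 2, inner ℝ ((1 + S.C 2) v) w = inner ℝ v ((1 + S.C 2) w)) ∧
    (∃ c : ℝ, 0 < c ∧ ∀ v : Lsigma S.Ω 2, c * ‖v‖ ^ 2 ≤ inner ℝ ((1 + S.C 2) v) v) := by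
  -- The coercivity constant is 1 because C itself is nonnegative.
  refine ⟨fun q _ _ _ => ?_, fun v w => ?_, 1, one_pos, fun v => ?_⟩
  · have h1 : (1 + S.C q) * (1 + S.K q) = 1 := by rw [S.C_eq_correction, S.mul_one_add_K]
    have h2 : (1 + S.K q) * (1 + S.C q) = 1 := by rw [S.C_eq_correction, S.one_add_K_mul]
    exact ⟨⟨h1, h2⟩, ⟨S.equivE q, fun _ => rfl, fun f g => Prod.ext ((1 + S.C q).map_add _ _) rfl⟩,
      S.finiteDimensional_range_C q, S.isCompactOperator_C q, ⟨⟨_, _, h1, h2⟩, rfl⟩⟩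
  · change inner ℝ (v + S.C 2 v) w = inner ℝ v (w + S.C 2 w)
    rw [inner_add_left, inner_add_right, S.inner_C_two_comm]
  · change 1 * ‖v‖ ^ 2 ≤ inner ℝ (v + S.C 2 v) v
    rw [inner_add_left, real_inner_self_eq_norm_sq, one_mul]
    exact le_add_of_nonneg_right (S.inner_C_two_nonneg v)
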